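/- Let $m,n\in\mathbb N$. For a real matrix $A$ write $\|A\|_F$ for its Frobenius norm and $\|A\|_2$ for its spectral norm (largest singular value); for symmetric positive definite $A=V\Lambda V^\top$ write $A^{p}=V\Lambda^{p}V^\top$. Let $f_1,f_2,\dots:\mathbb R^{m\times n}\to\mathbb R$ be loss functions. KrADagrad$^\star$ with step size $\eta>0$ and starting point $W_0\in\mathbb R^{m\times n}$ sets $L_0=I_m$, $R_0=I_n$ and, for $k=1,2,\dots$, obtains the gradient $G_k=\nabla f_k(W_{k-1})\in\mathbb R^{m\times n}$ and puts $$t_{k,L}=1+\|G_kG_k^\top L_{k-1}\|_F,\qquad t_{k,R}=1+\|G_k^\top G_kR_{k-1}\|_F,$$ $$L_k=L_{k-1}-\tfrac1{t_{k,L}}L_{k-1}G_kG_k^\top L_{k-1},\qquad R_k=R_{k-1}-\tfrac1{t_{k,R}}R_{k-1}G_k^\top G_kR_{k-1},$$ $$W_k=W_{k-1}-\eta\,L_k^{1/4}G_kR_k^{1/4}.$$ Theorem. There is a constant $C>0$, depending only on $m$ and $n$, such that the following holds for every $K\ge 0$, every $\eta>0$, every $W_0,W_*\in\mathbb R^{m\times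 n}$, every real $D$ and all losses $f_1,f_2,\dots$ for which, for $1\le k\le K$, $f_k$ is convex, $f_k$ is differentiable at $W_{k-1}$, and $\|W_{k-1}-W_*\|_F\le D$. (a) If $f_1,\dots,f_K$ are 1-Lipschitz, i.e. $|f_k(X)-f_k(Y)|\le\|X-Y\|_F$ for all $X,Y$, then $\|G_k\|_2\le 1$ for $1\le k\le K$. (b) If $\|G_k\|_2\le 1$ for $1\le k\le K$ (in particular, by (a), if the losses are 1-Lipschitz), then the online regret of KrADagrad$^\star$ satisfies $$\sum_{k=1}^{K}\bigl(f_k(W_{k-1})-f_k(W_*)\bigr)\;\le\; C\Bigl(\frac{D^2}{\eta}+\eta\Bigr)\sqrt K .$$ Thus, with $\eta$ and $D$ fixed, the regret is $O(\sqrt K)$. -/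

import Mathlib

open scoped Matrix

namespace KrADagrad

noncomputable section

/-- The Frobenius norm `‖A‖_F = (tr (Aᵀ A))^{1/2}`. -/
def frobNorm {m n : ℕ} (A : Matrix (Fin m) (Fin n) ℝ) : ℝ :=
  Real.sqrt (Matrix.trace (Aᵀ * A))

section SpectralNorm

open scoped Matrix.Norms.L2Operator

/-- The spectral norm `‖A‖₂`: the operator norm of `A` between Euclidean spaces,
that is, the largest singular value of `A`. -/
def specNorm {m n : ℕ} (A : Matrix (Fin m) (Fin n) ℝ) : ℝ :=
  ‖A‖

end SpectralNorm

/-- The real power `A ^ p` of a symmetric positive definite matrix `A = V Λ Vᵀ`, namely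
`V Λ ^ p Vᵀ` (continuous functional calculus of symmetric real matrices). -/
def matrixRpow {m : ℕ} (A : Matrix (Fin m) (Fin m) ℝ) (p : ℝ) : Matrix (Fin m) (Fin m) ℝ :=
  cfc (fun x : ℝ => x ^ p) A

/-- The gradient of `f` at `W`: the matrix of partial derivatives `∂f / ∂W_{ij}`. -/
def matrixGradient {m n : ℕ} (f : Matrix (Fin m) (Fin n) ℝ → ℝ)
    (W : Matrix (Fin m) (Fin n) ℝ) : Matrix (Fin m) (Fin n) ℝ :=
  Matrix.of fun i j => fderiv ℝ f W (Matrix.single i j 1)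

/-- `f` is 1-Lipschitz in the Euclidean norm of the parameter vector `vec W`, which is the
Frobenius norm of `W`. -/
def IsOneLipschitz {m n : ℕ} (f : Matrix (Fin m) (Fin n) ℝ → ℝ) : Prop :=
  ∀ X Y : Matrix (Fin m) (Fin n) ℝ, |f X - f Y| ≤ frobNorm (X - Y)

/-- The KrAD update of one statistic `S` from a positive semidefinite matrix `A`:
`S - (1 / t) S A S` with `t = 1 + ‖A S‖_F`. -/
def statUpdate {m : ℕ} (S A : Matrix (Fin m) (Fin m) ℝ) : Matrix (Fin m) (Fin m) ℝ :=
  S - (1 / (1 + frobNorm (A * S))) • (S * A * S)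

/-- What the algorithm stores after an iteration: the parameters `W` and the left and right
statistics `L`, `R`. -/
structure State (m n : ℕ) where
  W : Matrix (Fin m) (Fin n) ℝ
  L : Matrix (Fin m) (Fin m) ℝ
  R : Matrix (Fin n) (Fin n) ℝ

/-- One iteration of KrADagrad⋆ with step size `η` (and exponent `α = 1/2`, so that the
preconditioners are the powers `α / 2 = 1/4` of the updated statistics), given the loss `f` of
this iteration. -/
def step {m n : ℕ} (η : ℝ) (f : Matrix (Fin m) (Fin n) ℝ → ℝ) (s : State m n) : State m n :=
  let G := matrixGradient f s.W
  let L := statUpdate s.L (G * Gᵀ)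
  let R := statUpdate s.R (Gᵀ * G)
  { W := s.W - η • (matrixRpow L (1 / 4) * G * matrixRpow R (1 / 4))
    L := L
    R := R }

/-- The run of KrADagrad⋆ from `W₀`, with `L₀ = I`, `R₀ = I`. The state after `k` iterations
is `run η f W₀ k`; iteration `k + 1` uses the loss `f k`. -/
def run {m n : ℕ} (η : ℝ) (f : ℕ → Matrix (Fin m) (Fin n) ℝ → ℝ)
    (W₀ : Matrix (Fin m) (Fin n) ℝ) : ℕ → State m n
  | 0 => { W := W₀, L := 1, R := 1 }
  | k + 1 => step η (f k) (run η f W₀ k)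

/-- The parameters after `k` iterations; the loss `f k` is suffered at, and its gradient taken at,
`iterate η f W₀ k`. -/
def iterate {m n : ℕ} (η : ℝ) (f : ℕ → Matrix (Fin m) (Fin n) ℝ → ℝ)
    (W₀ : Matrix (Fin m) (Fin n) ℝ) (k : ℕ) : Matrix (Fin m) (Fin n) ℝ :=
  (run η f W₀ k).W

/-- The online regret of KrADagrad⋆ over `K` iterations against the fixed parameters `Wstar`. -/
def regret {m n : ℕ} (η : ℝ) (f : ℕ → Matrix (Fin m) (Fin n) ℝ → ℝ)
    (W₀ Wstar : Matrix (Fin m) (Fin n) ℝ) (K : ℕ) : ℝ :=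
  ∑ k ∈ Finset.range K, (f k (iterate η f W₀ k) - f k Wstar)

end

end KrADagrad

namespace KrADagrad

open Matrix

variable {m n : ℕ}

/-! The inverse statistics behave like Shampoo's: in the Loewner order, `L_k⁻¹` lies between
`L_{k-1}⁻¹ + G Gᵀ / t` and `L_{k-1}⁻¹ + G Gᵀ` (`statUpdate_spec`), and likewise for `R`. The lower
bound makes `L_k^(-1/4)` and `R_k^(-1/4)` increase. With `‖G‖₂ ≤ 1`, the upper bound gives `L_k⁻¹ ≤
(1 + k) • 1`, and `t ≤ 1 + √m` because `L ≤ 1`.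

The rest is online mirror descent in the metric `tr (Xᵀ P X Q)`, `P = L_k^(-1/4)`, `Q = R_k^(-1/4)`,
where `X` is the distance to the comparator. Convexity bounds the loss gap by `tr (Gᵀ X)`, and
`energy_step` writes this as an energy decrease plus a gradient term. The decreases telescope up to
metric growth, giving `D² tr P_K tr Q_K = O(D² √K)` (`sum_energy_le`). The gradient term splits by
AM-GM into `tr (L^(1/2) G Gᵀ)` and its right analogue, each dominated by increments of `tr L^(-1/2)`
or `tr R^(-1/2)`, which sum to `O(√K)` (`sum_trace_statistic_le`). -/

theorem _root_.Matrix.PosSemidef.transpose_conj {A : Matrix (Fin m) (Fin m) ℝ} (hA : A.PosSemidef)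
    (B : Matrix (Fin m) (Fin n) ℝ) : (Bᵀ * A * B).PosSemidef := by
  simpa [conjTranspose_eq_transpose_of_trivial] using hA.conjTranspose_mul_mul_same B

theorem posSemidef_transpose_mul_self (B : Matrix (Fin m) (Fin n) ℝ) : (Bᵀ * B).PosSemidef := by
  simpa using PosSemidef.one.transpose_conj B

theorem posSemidef_mul_transpose_self (B : Matrix (Fin m) (Fin n) ℝ) : (B * Bᵀ).PosSemidef := by
  simpa using posSemidef_transpose_mul_self Bᵀ

theorem _root_.Matrix.PosSemidef.transpose_eq {A : Matrix (Fin m) (Fin m) ℝ} (hA : A.PosSemidef) :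
    Aᵀ = A := by
  simpa [conjTranspose_eq_transpose_of_trivial] using hA.isHermitian.eq

/-! ### Real powers of positive definite matrices -/

section Rpow

variable {A : Matrix (Fin m) (Fin m) ℝ}

theorem spectrum_pos_of_posDef (hA : A.PosDef) {x : ℝ} (hx : x ∈ spectrum ℝ A) : 0 < x := by
  rw [hA.isHermitian.spectrum_real_eq_range_eigenvalues] at hx
  obtain ⟨i, rfl⟩ := hx
  exact hA.eigenvalues_pos i

/-- A finite spectrum makes continuity automatic, so negative exponents need no care at zero. -/
theorem continuousOn_spectrum (A : Matrix (Fin m) (Fin m) ℝ) (f : ℝ → ℝ) :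
    ContinuousOn f (spectrum ℝ A) :=
  A.finite_real_spectrum.continuousOn f

theorem matrixRpow_mul_matrixRpow (hA : A.PosDef) (p q : ℝ) :
    matrixRpow A p * matrixRpow A q = matrixRpow A (p + q) := by
  unfold matrixRpow
  rw [← cfc_mul _ _ A (continuousOn_spectrum A _) (continuousOn_spectrum A _)]
  exact cfc_congr fun x hx => (Real.rpow_add (spectrum_pos_of_posDef hA hx) p q).symm

theorem matrixRpow_zero (hA : A.PosDef) : matrixRpow A 0 = 1 := by
  simp only [matrixRpow, Real.rpow_zero]
  exact cfc_const_one ℝ A hA.isHermitian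

theorem matrixRpow_one (hA : A.PosDef) : matrixRpow A 1 = A := by
  simp only [matrixRpow, Real.rpow_one]
  exact cfc_id' ℝ A hA.isHermitian

theorem matrixRpow_mul_matrixRpow_neg (hA : A.PosDef) (p : ℝ) :
    matrixRpow A p * matrixRpow A (-p) = 1 := by
  rw [matrixRpow_mul_matrixRpow hA, add_neg_cancel, matrixRpow_zero hA]

theorem isHermitian_matrixRpow (A : Matrix (Fin m) (Fin m) ℝ) (p : ℝ) :
    (matrixRpow A p).IsHermitian :=
  cfc_predicate _ A

theorem posDef_matrixRpow (hA : A.PosDef) (p : ℝ) : (matrixRpow A p).PosDef := by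
  have h1 : matrixRpow A p = star (matrixRpow A (p / 2)) * 1 * matrixRpow A (p / 2) := by
    rw [star_eq_conjTranspose, (isHermitian_matrixRpow A _).eq, mul_one,
      matrixRpow_mul_matrixRpow hA, add_halves]
  have hu : IsUnit (matrixRpow A (p / 2)) :=
    IsUnit.of_mul_eq_one _ (matrixRpow_mul_matrixRpow_neg hA (p / 2))
  rw [h1]
  exact (hu.posDef_star_left_conjugate_iff).2 PosDef.one

theorem matrixRpow_one_eq_one (p : ℝ) : matrixRpow (1 : Matrix (Fin m) (Fin m) ℝ) p = 1 := by
  have h : matrixRpow (1 : Matrix (Fin m) (Fin m) ℝ) p =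
      cfc (fun x : ℝ => x ^ p) (algebraMap ℝ (Matrix (Fin m) (Fin m) ℝ) 1) := by
    rw [map_one]; rfl
  rw [h, cfc_algebraMap]; simp

end Rpow

/-! ### Loewner order and traces -/

section Order

/-- The square root is monotone in the Loewner order. -/
theorem posSemidef_sub_of_sq {X Y : Matrix (Fin m) (Fin m) ℝ} (hX : X.PosSemidef)
    (hY : Y.PosSemidef) (h : (X * X - Y * Y).PosSemidef) : (X - Y).PosSemidef := by
  have hM : (X - Y).IsHermitian := hX.isHermitian.sub hY.isHermitian
  rw [hM.posSemidef_iff_eigenvalues_nonneg]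
  intro i
  by_contra! hlt
  simp only [Pi.zero_apply] at hlt
  set v : Fin m → ℝ := (hM.eigenvectorBasis i).ofLp with hv
  set l := hM.eigenvalues i
  have hev : (X - Y) *ᵥ v = l • v := hM.mulVec_eigenvectorBasis i
  have hne : v ≠ 0 := by
    intro h0
    apply hM.eigenvectorBasis.orthonormal.ne_zero i
    ext j
    exact congrFun h0 j
  have hvv : 0 < v ⬝ᵥ v := by
    have := dotProduct_star_self_pos_iff.2 hne
    simpa using this
  have hx := hX.dotProduct_mulVec_nonneg v
  have hy := hY.dotProduct_mulVec_nonneg v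
  have hs := h.dotProduct_mulVec_nonneg v
  simp only [star_trivial] at hx hy hs
  have hev' : v ᵥ* (X - Y) = l • v := by
    rw [← mulVec_transpose, transpose_sub, hX.transpose_eq, hY.transpose_eq, hev]
  -- `X` and `Y` need not commute, so the difference of squares is symmetrized; the eigenvector `v`
  -- of `X - Y` then absorbs the factor on either side.
  have e1 : (2 : ℝ) • (X * X - Y * Y) = (X - Y) * (X + Y) + (X + Y) * (X - Y) := by
    rw [two_smul]; noncomm_ring
  have e2 : 2 * (v ⬝ᵥ ((X * X - Y * Y) *ᵥ v)) = 2 * (l * (v ⬝ᵥ (X *ᵥ v) + v ⬝ᵥ (Y *ᵥ v))) := by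
    rw [← smul_eq_mul, ← dotProduct_smul, ← smul_mulVec, e1, add_mulVec, dotProduct_add,
      ← mulVec_mulVec, ← mulVec_mulVec, hev, dotProduct_mulVec v (X - Y), hev']
    simp [add_mulVec, mulVec_smul, dotProduct_add]
    ring
  have e3 : v ⬝ᵥ (X *ᵥ v) - v ⬝ᵥ (Y *ᵥ v) = l * (v ⬝ᵥ v) := by
    rw [← dotProduct_sub, ← sub_mulVec, hev, dotProduct_smul, smul_eq_mul]
  -- Since `l < 0`. Both forms are nonnegative, so both vanish, contradicting `e3`.
  have h4 : v ⬝ᵥ (X *ᵥ v) + v ⬝ᵥ (Y *ᵥ v) ≤ 0 := by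
    by_contra! hc
    nlinarith
  nlinarith

theorem posSemidef_smul_one_sub_of_eigenvalues_le {M : Matrix (Fin m) (Fin m) ℝ}
    (hM : M.IsHermitian) {c : ℝ} (h : ∀ i, hM.eigenvalues i ≤ c) :
    (c • (1 : Matrix (Fin m) (Fin m) ℝ) - M).PosSemidef := by
  have e : c • (1 : Matrix (Fin m) (Fin m) ℝ) - M =
      Unitary.conjStarAlgAut ℝ _ hM.eigenvectorUnitary
        (diagonal fun i => c - hM.eigenvalues i) := by
    have : (diagonal fun i => c - hM.eigenvalues i) =
        c • (1 : Matrix (Fin m) (Fin m) ℝ) - diagonal ((RCLike.ofReal : ℝ → ℝ) ∘ hM.eigenvalues) := by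
      rw [smul_one_eq_diagonal, diagonal_sub]; rfl
    rw [this, map_sub, ← hM.spectral_theorem, map_smul, map_one]
  rw [e, Unitary.conjStarAlgAut_apply]
  refine (Unitary.isUnit_coe.posSemidef_star_right_conjugate_iff).2 ?_
  exact PosSemidef.diagonal fun i => sub_nonneg.2 (h i)

theorem posSemidef_trace_smul_one_sub {M : Matrix (Fin m) (Fin m) ℝ} (hM : M.PosSemidef) :
    (M.trace • (1 : Matrix (Fin m) (Fin m) ℝ) - M).PosSemidef := by
  refine posSemidef_smul_one_sub_of_eigenvalues_le hM.isHermitian fun i => ?_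
  rw [hM.isHermitian.trace_eq_sum_eigenvalues]
  exact Finset.single_le_sum (f := hM.isHermitian.eigenvalues)
    (fun j _ => hM.eigenvalues_nonneg j) (Finset.mem_univ i)

open scoped MatrixOrder in
theorem exists_mul_transpose_eq {N : Matrix (Fin m) (Fin m) ℝ} (hN : N.PosSemidef) :
    ∃ B : Matrix (Fin m) (Fin m) ℝ, N = B * Bᵀ := by
  obtain ⟨B, hB⟩ := CStarAlgebra.nonneg_iff_eq_mul_star_self.1 hN.nonneg
  exact ⟨B, by simpa [star_eq_conjTranspose, conjTranspose_eq_transpose_of_trivial] using hB⟩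

open scoped MatrixOrder in
theorem _root_.Matrix.PosSemidef.mul_of_commute {M N : Matrix (Fin m) (Fin m) ℝ} (hM : M.PosSemidef)
    (hN : N.PosSemidef) (h : Commute M N) : (M * N).PosSemidef := by
  rw [← nonneg_iff_posSemidef] at *
  exact Commute.mul_nonneg hM hN h

theorem trace_mul_nonneg {M N : Matrix (Fin m) (Fin m) ℝ} (hM : M.PosSemidef)
    (hN : N.PosSemidef) : 0 ≤ (M * N).trace := by
  obtain ⟨B, rfl⟩ := exists_mul_transpose_eq hN
  rw [← mul_assoc, trace_mul_comm, ← mul_assoc]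
  exact (hM.transpose_conj B).trace_nonneg

theorem trace_mul_le_trace_mul {M M' N : Matrix (Fin m) (Fin m) ℝ} (h : (M' - M).PosSemidef)
    (hN : N.PosSemidef) : (M * N).trace ≤ (M' * N).trace := by
  have := trace_mul_nonneg h hN
  rw [sub_mul, trace_sub] at this
  linarith

theorem trace_le_trace {M M' : Matrix (Fin m) (Fin m) ℝ} (h : (M' - M).PosSemidef) :
    M.trace ≤ M'.trace := by
  simpa [trace_sub] using h.trace_nonneg

end Order

/-! ### Halving exponents in Loewner inequalities -/

section MatrixRpowOrder

variable {A B : Matrix (Fin m) (Fin m) ℝ}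

theorem matrixRpow_half_sub_posSemidef (hA : A.PosDef) (hB : B.PosDef) {p : ℝ}
    (h : (matrixRpow A p - matrixRpow B p).PosSemidef) :
    (matrixRpow A (p / 2) - matrixRpow B (p / 2)).PosSemidef := by
  refine posSemidef_sub_of_sq (posDef_matrixRpow hA _).posSemidef
    (posDef_matrixRpow hB _).posSemidef ?_
  rwa [matrixRpow_mul_matrixRpow hA, matrixRpow_mul_matrixRpow hB, add_halves]

theorem smul_one_sub_matrixRpow_half_posSemidef (hA : A.PosDef) {p c : ℝ} (hc : 0 ≤ c)
    (h : (c • (1 : Matrix (Fin m) (Fin m) ℝ) - matrixRpow A p).PosSemidef) :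
    (√c • (1 : Matrix (Fin m) (Fin m) ℝ) - matrixRpow A (p / 2)).PosSemidef := by
  refine posSemidef_sub_of_sq (PosSemidef.one.smul (Real.sqrt_nonneg c))
    (posDef_matrixRpow hA _).posSemidef ?_
  rw [matrixRpow_mul_matrixRpow hA, add_halves, smul_mul_smul_comm, Real.mul_self_sqrt hc, one_mul]
  exact h

theorem trace_le_of_smul_one_sub_posSemidef {c : ℝ}
    (h : (c • (1 : Matrix (Fin m) (Fin m) ℝ) - A).PosSemidef) : A.trace ≤ m * c := by
  have := trace_le_trace h
  simpa [mul_comm] using this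

end MatrixRpowOrder

/-! ### Frobenius norm and trace inequalities -/

section Frobenius

theorem frobNorm_nonneg (A : Matrix (Fin m) (Fin n) ℝ) : 0 ≤ frobNorm A := Real.sqrt_nonneg _

theorem frobNorm_sq (A : Matrix (Fin m) (Fin n) ℝ) : frobNorm A ^ 2 = (Aᵀ * A).trace :=
  Real.sq_sqrt (posSemidef_transpose_mul_self A).trace_nonneg

theorem trace_mul_self_le (M : Matrix (Fin m) (Fin m) ℝ) : (M * M).trace ≤ (Mᵀ * M).trace := by
  have h := (posSemidef_transpose_mul_self (M - Mᵀ)).trace_nonneg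
  rw [transpose_sub, transpose_transpose, sub_mul, mul_sub, mul_sub] at h
  simp only [trace_sub] at h
  have h1 : (Mᵀ * Mᵀ).trace = (M * M).trace := by rw [← transpose_mul, trace_transpose]
  have h2 : (M * Mᵀ).trace = (Mᵀ * M).trace := trace_mul_comm _ _
  linarith

theorem trace_transpose_mul_le (X Y : Matrix (Fin m) (Fin n) ℝ) :
    2 * (Xᵀ * Y).trace ≤ (Xᵀ * X).trace + (Yᵀ * Y).trace := by
  have h := (posSemidef_transpose_mul_self (X - Y)).trace_nonneg
  rw [transpose_sub, Matrix.sub_mul, Matrix.mul_sub, Matrix.mul_sub] at h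
  simp only [trace_sub] at h
  have h1 : (Yᵀ * X).trace = (Xᵀ * Y).trace := by
    rw [← trace_transpose, transpose_mul, transpose_transpose]
  linarith

/-- A positive semidefinite matrix is at most its trace times the identity; this is applied to `N`,
then to `M`. -/
theorem trace_quadratic_le {M : Matrix (Fin m) (Fin m) ℝ} {N : Matrix (Fin n) (Fin n) ℝ}
    (hM : M.PosSemidef) (hN : N.PosSemidef) (X : Matrix (Fin m) (Fin n) ℝ) :
    (Xᵀ * M * X * N).trace ≤ frobNorm X ^ 2 * (M.trace * N.trace) := by
  have h1 := trace_mul_le_trace_mul (posSemidef_trace_smul_one_sub hN) (hM.transpose_conj X)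
  have h2 := trace_mul_le_trace_mul (posSemidef_trace_smul_one_sub hM)
    (posSemidef_mul_transpose_self X)
  rw [smul_mul_assoc, one_mul, trace_smul, smul_eq_mul] at h1 h2
  have e1 : (M * (X * Xᵀ)).trace = (Xᵀ * M * X).trace := by
    rw [← Matrix.mul_assoc, trace_mul_comm, Matrix.mul_assoc]
  rw [trace_mul_comm N] at h1
  rw [e1] at h2
  rw [frobNorm_sq, trace_mul_comm Xᵀ X]
  nlinarith [hN.trace_nonneg]

end Frobenius

/-! ### One update of a statistic -/

section StatUpdate

variable {S : Matrix (Fin m) (Fin m) ℝ}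

/-- The largest eigenvalue of `S^{1/2} A S^{1/2}` is at most the Frobenius norm of `A S`. -/
theorem frobNorm_smul_one_sub_posSemidef (hS : S.PosDef) {A : Matrix (Fin m) (Fin m) ℝ}
    (hA : A.PosSemidef) :
    (frobNorm (A * S) • (1 : Matrix (Fin m) (Fin m) ℝ) -
      matrixRpow S (1 / 2) * A * matrixRpow S (1 / 2)).PosSemidef := by
  set H := matrixRpow S (1 / 2) with hH
  have hHp : H.PosSemidef := (posDef_matrixRpow hS _).posSemidef
  have hHH : H * H = S := by
    rw [hH, matrixRpow_mul_matrixRpow hS, add_halves, matrixRpow_one hS]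
  have hB : (H * A * H).PosSemidef := by
    simpa [hHp.transpose_eq] using hA.transpose_conj H
  refine posSemidef_sub_of_sq (PosSemidef.one.smul (frobNorm_nonneg _)) hB ?_
  have hBB : (H * A * H * (H * A * H)).PosSemidef := by
    simpa [hB.transpose_eq] using posSemidef_transpose_mul_self (H * A * H)
  -- By cyclicity the left side is `tr ((A S)²)`; `A S` itself need not be symmetric.
  have htr : (H * A * H * (H * A * H)).trace ≤ frobNorm (A * S) ^ 2 := by
    rw [frobNorm_sq]
    refine le_trans (le_of_eq ?_) (trace_mul_self_le (A * S))
    rw [← hHH, mul_assoc H A H, mul_assoc H (A * H), trace_mul_comm]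
    simp only [mul_assoc]
  have h2 : ((frobNorm (A * S) ^ 2 - (H * A * H * (H * A * H)).trace) •
      (1 : Matrix (Fin m) (Fin m) ℝ)).PosSemidef := PosSemidef.one.smul (sub_nonneg.2 htr)
  have := h2.add (posSemidef_trace_smul_one_sub hBB)
  rw [sub_smul, sub_add_sub_cancel] at this
  rwa [smul_mul_smul_comm, one_mul, ← sq]

/-- Conjugating by `S^(1/2)` reduces everything to functions of `B = S^(1/2) A S^(1/2)`, with `0 ≤ B
≤ c`: the update becomes `E = 1 - u B` and its inverse `F`, where `u = 1 / (1 + c)`. The choice of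
`t` is what keeps `E` positive definite. -/
theorem statUpdate_spec (hS : S.PosDef) {A : Matrix (Fin m) (Fin m) ℝ} (hA : A.PosSemidef) :
    (statUpdate S A).PosDef ∧ (S - statUpdate S A).PosSemidef ∧
    (matrixRpow (statUpdate S A) (-1) - matrixRpow S (-1) -
      (1 / (1 + frobNorm (A * S))) • A).PosSemidef ∧
    (matrixRpow S (-1) + A - matrixRpow (statUpdate S A) (-1)).PosSemidef := by
  set c := frobNorm (A * S) with hc
  have hc0 : 0 ≤ c := frobNorm_nonneg _
  have hcB := frobNorm_smul_one_sub_posSemidef hS hA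
  rw [← hc] at hcB
  set H := matrixRpow S (1 / 2) with hH
  set K := matrixRpow S (-(1 / 2)) with hK
  have hHp : H.PosSemidef := (posDef_matrixRpow hS _).posSemidef
  have hKp : K.PosSemidef := (posDef_matrixRpow hS _).posSemidef
  have hHH : H * H = S := by
    rw [hH, matrixRpow_mul_matrixRpow hS, add_halves, matrixRpow_one hS]
  have hKK : K * K = matrixRpow S (-1) := by
    rw [hK, matrixRpow_mul_matrixRpow hS]; norm_num
  have hHK : H * K = 1 := matrixRpow_mul_matrixRpow_neg hS _
  have hKH : K * H = 1 := mul_eq_one_comm.1 hHK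
  set B := H * A * H with hBdef
  have hB : B.PosSemidef := by
    simpa [hHp.transpose_eq] using hA.transpose_conj H
  have hKBK : K * B * K = A := by
    rw [hBdef]
    calc K * (H * A * H) * K = (K * H) * A * (H * K) := by simp only [mul_assoc]
      _ = A := by rw [hHK, hKH, one_mul, mul_one]
  have ht : 0 < 1 + c := by positivity
  set u := 1 / (1 + c) with hu
  have hu0 : 0 < u := by positivity
  have huc : u * (1 + c) = 1 := by rw [hu]; field_simp
  set E : Matrix (Fin m) (Fin m) ℝ := 1 - u • B with hE
  have hEp : E.PosDef := by
    have : E = u • (1 + (c • (1 : Matrix (Fin m) (Fin m) ℝ) - B)) := by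
      have h1 : (1 : Matrix (Fin m) (Fin m) ℝ) = (u * (1 + c)) • 1 := by rw [huc, one_smul]
      rw [hE]
      nth_rewrite 1 [h1]
      module
    rw [this]
    exact (PosDef.one.add_posSemidef hcB).smul hu0
  have hL : statUpdate S A = H * E * H := by
    rw [statUpdate, hE, ← hc, ← hu, mul_sub, sub_mul, mul_one, hHH, mul_smul_comm, smul_mul_assoc,
      hBdef, ← hHH]
    simp only [mul_assoc]
  have hLp : (statUpdate S A).PosDef := by
    have h := (IsUnit.of_mul_eq_one _ hHK).posDef_star_left_conjugate_iff.2 hEp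
    rwa [star_eq_conjTranspose, conjTranspose_eq_transpose_of_trivial, hHp.transpose_eq, ← hL] at h
  set F := matrixRpow E (-1) with hF
  have hFp : F.PosDef := posDef_matrixRpow hEp _
  have hEF : E * F = 1 := by
    have := matrixRpow_mul_matrixRpow_neg hEp 1
    rwa [matrixRpow_one hEp] at this
  have hFE : F * E = 1 := mul_eq_one_comm.1 hEF
  have hLi : matrixRpow (statUpdate S A) (-1) = K * F * K := by
    have h1 := matrixRpow_mul_matrixRpow_neg hLp 1
    rw [matrixRpow_one hLp] at h1
    have h2 : K * F * K * statUpdate S A = 1 := by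
      rw [hL]
      calc K * F * K * (H * E * H) = K * (F * ((K * H) * E)) * H := by simp only [mul_assoc]
        _ = 1 := by rw [hKH, one_mul, hFE, mul_one, hKH]
    exact (left_inv_eq_right_inv h2 h1).symm
  have huB : u • B = 1 - E := by rw [hE, sub_sub_cancel]
  refine ⟨hLp, ?_, ?_, ?_⟩
  · have e : S - statUpdate S A = u • (Hᵀ * B * H) := by
      rw [hL, hE, mul_sub, sub_mul, mul_one, hHH, sub_sub_cancel, hHp.transpose_eq, mul_smul_comm,
        smul_mul_assoc]
    rw [e]
    exact (hB.transpose_conj _).smul hu0.le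
  · rw [hLi, ← hKK, ← hKBK]
    -- The remainder of the geometric series: `F - 1 - u B = (u B) F (u B)`.
    have e : K * F * K - K * K - u • (K * B * K) = Kᵀ * ((u • B)ᵀ * F * (u • B)) * K := by
      rw [hKp.transpose_eq, transpose_smul, hB.transpose_eq, ← smul_mul_assoc, ← mul_smul_comm, huB]
      have : (1 - E) * F * (1 - E) = F - 1 - (1 - E) := by
        rw [sub_mul, one_mul, hEF, mul_sub, mul_one, sub_mul, hFE, one_mul]
      rw [this]; noncomm_ring
    rw [e]
    exact (hFp.posSemidef.transpose_conj _).transpose_conj _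
  · have hBE : B * E = E * B := by
      rw [hE, mul_sub, sub_mul, mul_one, one_mul, mul_smul_comm, smul_mul_assoc]
    have hFB : F * B = B * F := by
      calc F * B = F * (B * E) * F := by rw [mul_assoc, mul_assoc, hEF, mul_one]
        _ = B * F := by rw [hBE, ← mul_assoc, hFE, one_mul]
    have hcF : Commute F (c • (1 : Matrix (Fin m) (Fin m) ℝ) - B) := by
      rw [commute_iff_eq, mul_sub, sub_mul, hFB]; simp
    have hcB' : Commute (F * (c • (1 : Matrix (Fin m) (Fin m) ℝ) - B)) B := by
      refine Commute.mul_left hFB ?_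
      rw [commute_iff_eq, mul_sub, sub_mul]; simp
    have hP := (hFp.posSemidef.mul_of_commute hcB hcF).mul_of_commute hB hcB'
    -- Scalar model: `1 + b - 1 / (1 - u b) = u b (c - b) / (1 - u b)`, using `1 - u = u c`. The
    -- factors commute, so the product is positive semidefinite.
    have e1 : 1 + B - F = u • (F * (c • (1 : Matrix (Fin m) (Fin m) ℝ) - B) * B) := by
      have h1 : u • (c • (1 : Matrix (Fin m) (Fin m) ℝ) - B) = E - u • 1 := by
        have h1 : (1 : Matrix (Fin m) (Fin m) ℝ) = (u * (1 + c)) • 1 := by rw [huc, one_smul]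
        rw [hE]
        nth_rewrite 2 [h1]
        module
      rw [← smul_mul_assoc, ← mul_smul_comm, h1, mul_sub, hFE, sub_mul, mul_smul_comm, mul_one,
        smul_mul_assoc, one_mul, ← mul_smul_comm, huB, mul_sub, hFE, mul_one]
      abel
    have e : matrixRpow S (-1) + A - K * F * K = Kᵀ * (1 + B - F) * K := by
      rw [hKp.transpose_eq, ← hKK]
      nth_rewrite 1 [← hKBK]
      noncomm_ring
    rw [hLi, e, e1]
    exact (hP.smul hu0.le).transpose_conj _

end StatUpdate

/-! ### Gradients of convex and of Lipschitz losses -/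

section Gradient

open scoped Matrix.Norms.Elementwise in
theorem hasDerivAt_line {f : Matrix (Fin m) (Fin n) ℝ → ℝ} {W : Matrix (Fin m) (Fin n) ℝ}
    (hf : DifferentiableAt ℝ f W) (V : Matrix (Fin m) (Fin n) ℝ) :
    HasDerivAt (fun t : ℝ => f (W + t • V)) (fderiv ℝ f W V) 0 :=
  hf.hasFDerivAt.hasLineDerivAt V

theorem fderiv_eq_trace (f : Matrix (Fin m) (Fin n) ℝ → ℝ) (W V : Matrix (Fin m) (Fin n) ℝ) :
    fderiv ℝ f W V = ((matrixGradient f W)ᵀ * V).trace := by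
  conv_lhs => rw [matrix_eq_sum_single V]
  have h (i : Fin m) (j : Fin n) : single i j (V i j) = V i j • single i j (1 : ℝ) := by simp
  simp only [h, map_sum, map_smul, smul_eq_mul, trace, diag_apply, mul_apply, transpose_apply,
    matrixGradient, of_apply]
  rw [Finset.sum_comm]
  simp only [mul_comm]

theorem sub_le_trace_gradient {f : Matrix (Fin m) (Fin n) ℝ → ℝ} {W : Matrix (Fin m) (Fin n) ℝ}
    (hc : ConvexOn ℝ Set.univ f) (hf : DifferentiableAt ℝ f W) (V : Matrix (Fin m) (Fin n) ℝ) :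
    f W - f V ≤ ((matrixGradient f W)ᵀ * (W - V)).trace := by
  have hd := hasDerivAt_line hf (V - W)
  have hg : ConvexOn ℝ Set.univ fun t : ℝ => f (W + t • (V - W)) := by
    have := hc.comp_affineMap (AffineMap.lineMap W V : ℝ →ᵃ[ℝ] Matrix (Fin m) (Fin n) ℝ)
    simpa [Function.comp_def, AffineMap.lineMap_apply, add_comm] using this
  have h := hg.le_slope_of_hasDerivAt (Set.mem_univ 0) (Set.mem_univ 1) one_pos hd
  rw [slope_def_field, fderiv_eq_trace, ← neg_sub W V, Matrix.mul_neg, trace_neg] at h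
  simp only [one_smul, zero_smul, add_zero, sub_zero, div_one] at h
  have e : W + -(W - V) = V := by abel
  rw [e] at h
  linarith

theorem fderiv_le_frobNorm {f : Matrix (Fin m) (Fin n) ℝ → ℝ} {W : Matrix (Fin m) (Fin n) ℝ}
    (hl : IsOneLipschitz f) (hf : DifferentiableAt ℝ f W) (V : Matrix (Fin m) (Fin n) ℝ) :
    fderiv ℝ f W V ≤ frobNorm V := by
  have hd := (hasDerivAt_line hf V).tendsto_slope_zero_right
  refine le_of_tendsto hd ?_
  filter_upwards [self_mem_nhdsWithin] with t ht
  have ht : 0 < t := ht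
  have h := (le_abs_self _).trans (hl (W + t • V) W)
  have e : frobNorm (t • V) = t * frobNorm V := by
    rw [frobNorm, transpose_smul, Matrix.smul_mul, Matrix.mul_smul, smul_smul, trace_smul, smul_eq_mul,
      Real.sqrt_mul (mul_self_nonneg t), Real.sqrt_mul_self ht.le, frobNorm]
  rw [add_sub_cancel_left, e] at h
  simp only [zero_add, zero_smul, add_zero, smul_eq_mul]
  rwa [inv_mul_le_iff₀ ht]

/-- Differentiating along the gradient itself gives `‖G‖_F² ≤ ‖G‖_F`. -/
theorem frobNorm_gradient_le_one {f : Matrix (Fin m) (Fin n) ℝ → ℝ}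
    {W : Matrix (Fin m) (Fin n) ℝ} (hl : IsOneLipschitz f) (hf : DifferentiableAt ℝ f W) :
    frobNorm (matrixGradient f W) ≤ 1 := by
  have h := fderiv_le_frobNorm hl hf (matrixGradient f W)
  rw [fderiv_eq_trace, ← frobNorm_sq] at h
  nlinarith [frobNorm_nonneg (matrixGradient f W)]

end Gradient

/-! ### Spectral norm in Loewner form -/

section SpectralNorm

variable {G : Matrix (Fin m) (Fin n) ℝ}

theorem norm_toLp_sq (x : Fin m → ℝ) : ‖WithLp.toLp 2 x‖ ^ 2 = x ⬝ᵥ x := by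
  rw [EuclideanSpace.real_norm_sq_eq, dotProduct]
  simp [sq]

theorem dotProduct_transpose_mul_mulVec (G : Matrix (Fin m) (Fin n) ℝ) (x : Fin n → ℝ) :
    x ⬝ᵥ ((Gᵀ * G) *ᵥ x) = (G *ᵥ x) ⬝ᵥ (G *ᵥ x) := by
  rw [← mulVec_mulVec, dotProduct_mulVec, vecMul_transpose]

open scoped Matrix.Norms.L2Operator in
theorem specNorm_transpose (G : Matrix (Fin m) (Fin n) ℝ) : specNorm Gᵀ = specNorm G := by
  rw [specNorm, ← conjTranspose_eq_transpose_of_trivial, l2_opNorm_conjTranspose, specNorm]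

open scoped Matrix.Norms.L2Operator in
theorem one_sub_transpose_mul_self_posSemidef (hG : specNorm G ≤ 1) :
    (1 - Gᵀ * G).PosSemidef := by
  refine PosSemidef.of_dotProduct_mulVec_nonneg
    (isHermitian_one.sub (posSemidef_transpose_mul_self G).isHermitian) fun x => ?_
  rw [star_trivial, sub_mulVec, dotProduct_sub, dotProduct_transpose_mul_mulVec, one_mulVec,
    ← norm_toLp_sq, ← norm_toLp_sq, sub_nonneg]
  have h := l2_opNorm_mulVec G (WithLp.toLp 2 x)
  have h2 : ‖G‖ * ‖WithLp.toLp 2 x‖ ≤ 1 * ‖WithLp.toLp 2 x‖ :=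
    mul_le_mul_of_nonneg_right hG (norm_nonneg _)
  rw [one_mul] at h2
  exact pow_le_pow_left₀ (norm_nonneg _) (h.trans h2) 2

open scoped Matrix.Norms.L2Operator in
theorem specNorm_le_frobNorm (G : Matrix (Fin m) (Fin n) ℝ) : specNorm G ≤ frobNorm G := by
  rw [specNorm, l2_opNorm_def]
  refine ContinuousLinearMap.opNorm_le_bound _ (frobNorm_nonneg G) fun x => ?_
  have h := (posSemidef_trace_smul_one_sub (posSemidef_transpose_mul_self G)).dotProduct_mulVec_nonneg
    x.ofLp
  rw [star_trivial, sub_mulVec, dotProduct_sub, dotProduct_transpose_mul_mulVec, smul_mulVec,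
    one_mulVec, dotProduct_smul, ← norm_toLp_sq, ← norm_toLp_sq, ← frobNorm_sq, smul_eq_mul,
    sub_nonneg, ← mul_pow] at h
  exact (sq_le_sq₀ (norm_nonneg _) (mul_nonneg (frobNorm_nonneg G) (norm_nonneg _))).1 h

end SpectralNorm

/-! ### Growth of the statistics along the run -/

section Statistic

/-- Since `(G Gᵀ)² ≤ 1` and `S ≤ 1`, the squared norm is at most `tr S² ≤ tr S ≤ m`. This bounds `t`
uniformly. -/
theorem frobNorm_mul_le {S : Matrix (Fin m) (Fin m) ℝ} {G : Matrix (Fin m) (Fin n) ℝ}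
    (hS : S.PosSemidef) (hS1 : (1 - S).PosSemidef) (hG : specNorm G ≤ 1) :
    frobNorm (G * Gᵀ * S) ≤ √m := by
  refine Real.sqrt_le_sqrt ?_
  have h1 : (1 - G * Gᵀ).PosSemidef := by
    simpa using one_sub_transpose_mul_self_posSemidef ((specNorm_transpose G).trans_le hG)
  have h2 : (1 - G * Gᵀ * (G * Gᵀ)).PosSemidef := by
    have h := h1.add ((one_sub_transpose_mul_self_posSemidef hG).transpose_conj Gᵀ)
    have e : 1 - G * Gᵀ + Gᵀᵀ * (1 - Gᵀ * G) * Gᵀ = 1 - G * Gᵀ * (G * Gᵀ) := by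
      rw [transpose_transpose, Matrix.mul_sub, Matrix.sub_mul, Matrix.mul_one]
      simp only [Matrix.mul_assoc]
      abel
    rwa [e] at h
  have hSS : (S * S).PosSemidef := by
    simpa [hS.transpose_eq] using posSemidef_transpose_mul_self S
  have h3 := trace_mul_le_trace_mul h2 hSS
  have h4 := trace_mul_le_trace_mul hS1 hS
  have h5 := trace_le_trace hS1
  have e : ((G * Gᵀ * S)ᵀ * (G * Gᵀ * S)).trace = (G * Gᵀ * (G * Gᵀ) * (S * S)).trace := by
    rw [transpose_mul, hS.transpose_eq, (posSemidef_mul_transpose_self G).transpose_eq,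
      mul_assoc, trace_mul_comm]
    simp only [mul_assoc]
  rw [e]
  simp only [one_mul, trace_one, Fintype.card_fin] at h3 h4 h5
  linarith

/-- Matrix form of `(x² - y²) / x ≤ 2 (x - y)`, with `X = L^(-1/2)` and `Y = S^(-1/2)`: it follows
from `tr (X⁻¹ (X - Y)²) ≥ 0`. -/
theorem trace_sqrt_mul_le {L S A : Matrix (Fin m) (Fin m) ℝ} {t T : ℝ} (hL : L.PosDef)
    (hS : S.PosDef) (hA : A.PosSemidef) (ht : 0 < t) (htT : t ≤ T)
    (h : (matrixRpow L (-1) - matrixRpow S (-1) - (1 / t) • A).PosSemidef) :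
    (matrixRpow L (1 / 2) * A).trace ≤
      T * (2 * ((matrixRpow L (-(1 / 2))).trace - (matrixRpow S (-(1 / 2))).trace)) := by
  set X := matrixRpow L (-(1 / 2)) with hX
  set Y := matrixRpow S (-(1 / 2)) with hY
  set Z := matrixRpow L (1 / 2) with hZ
  have hXX : X * X = matrixRpow L (-1) := by
    rw [hX, matrixRpow_mul_matrixRpow hL]; norm_num
  have hYY : Y * Y = matrixRpow S (-1) := by
    rw [hY, matrixRpow_mul_matrixRpow hS]; norm_num
  have hZX : Z * X = 1 := matrixRpow_mul_matrixRpow_neg hL _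
  have hXZ : X * Z = 1 := mul_eq_one_comm.1 hZX
  have hZp : Z.PosSemidef := (posDef_matrixRpow hL _).posSemidef
  have h0 : 0 ≤ (Z * A).trace := trace_mul_nonneg hZp hA
  have h1 := trace_mul_nonneg hZp h
  rw [← hXX, ← hYY, mul_sub, mul_sub, trace_sub, trace_sub, mul_smul_comm, trace_smul, smul_eq_mul,
    ← mul_assoc, hZX, one_mul] at h1
  have h2 : ((X - Y) * (X - Y)).PosSemidef := by
    have := posSemidef_transpose_mul_self (X - Y)
    rwa [transpose_sub, (posDef_matrixRpow hL _).posSemidef.transpose_eq,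
      (posDef_matrixRpow hS _).posSemidef.transpose_eq] at this
  have h3 := trace_mul_nonneg hZp h2
  have e : (Z * ((X - Y) * (X - Y))).trace = X.trace - 2 * Y.trace + (Z * (Y * Y)).trace := by
    have : Z * ((X - Y) * (X - Y)) = (Z * X) * X - (Z * X) * Y - Z * (Y * X) + Z * (Y * Y) := by
      noncomm_ring
    rw [this, hZX, one_mul, one_mul, trace_add, trace_sub, trace_sub, trace_mul_comm Z, mul_assoc,
      hXZ, mul_one]
    ring
  rw [e] at h3
  have h4 : 1 / t * (Z * A).trace ≤ 2 * (X.trace - Y.trace) := by linarith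
  rw [one_div, inv_mul_le_iff₀ ht] at h4
  -- Enlarging `t` to `T` needs a nonnegative trace increment, which `h0` and `h4` supply.
  refine h4.trans (mul_le_mul_of_nonneg_right htT ?_)
  exact nonneg_of_mul_nonneg_right (h0.trans h4) ht

variable {S : ℕ → Matrix (Fin m) (Fin m) ℝ} {G : ℕ → Matrix (Fin m) (Fin n) ℝ} {K : ℕ}

theorem statistic_bounds (h0 : S 0 = 1) (hs : ∀ k, S (k + 1) = statUpdate (S k) (G k * (G k)ᵀ))
    (hG : ∀ k < K, specNorm (G k) ≤ 1) : ∀ k ≤ K, (S k).PosDef ∧ (1 - S k).PosSemidef ∧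
      ((1 + k : ℝ) • (1 : Matrix (Fin m) (Fin m) ℝ) - matrixRpow (S k) (-1)).PosSemidef := by
  intro k
  induction k with
  | zero =>
    intro _
    rw [h0, matrixRpow_one_eq_one]
    refine ⟨PosDef.one, ?_, ?_⟩ <;> simp [PosSemidef.zero]
  | succ k ih =>
    intro hk
    obtain ⟨h1, h2, h3⟩ := ih (by omega)
    obtain ⟨g1, g2, -, g4⟩ := statUpdate_spec h1 (posSemidef_mul_transpose_self (G k))
    rw [← hs] at g1 g2 g4
    refine ⟨g1, by simpa using h2.add g2, ?_⟩
    have h4 : (1 - G k * (G k)ᵀ).PosSemidef := by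
      simpa using one_sub_transpose_mul_self_posSemidef
        ((specNorm_transpose (G k)).trans_le (hG k (by omega)))
    convert (h3.add h4).add g4 using 1
    push_cast
    module

theorem posDef_statistic (h0 : S 0 = 1) (hs : ∀ k, S (k + 1) = statUpdate (S k) (G k * (G k)ᵀ))
    (k : ℕ) : (S k).PosDef := by
  induction k with
  | zero => rw [h0]; exact PosDef.one
  | succ k ih =>
    rw [hs]
    exact (statUpdate_spec ih (posSemidef_mul_transpose_self (G k))).1

theorem statistic_rpow_neg_quarter_mono (h0 : S 0 = 1)
    (hs : ∀ k, S (k + 1) = statUpdate (S k) (G k * (G k)ᵀ)) (k : ℕ) :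
    (matrixRpow (S (k + 1)) (-(1 / 4)) - matrixRpow (S k) (-(1 / 4))).PosSemidef := by
  have h1 := posDef_statistic h0 hs k
  have h2 := posDef_statistic h0 hs (k + 1)
  have hA := posSemidef_mul_transpose_self (G k)
  obtain ⟨-, -, g, -⟩ := statUpdate_spec h1 hA
  rw [← hs] at g
  have ht : 0 ≤ 1 / (1 + frobNorm (G k * (G k)ᵀ * S k)) := by
    have := frobNorm_nonneg (G k * (G k)ᵀ * S k)
    positivity
  have g' := g.add (hA.smul ht)
  rw [sub_add_cancel] at g'
  -- Two square roots take the exponent from `-1` to `-1/4`.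
  convert matrixRpow_half_sub_posSemidef h2 h1 (matrixRpow_half_sub_posSemidef h2 h1 g') using 3 <;>
    norm_num

theorem trace_statistic_rpow_neg_half_le (h0 : S 0 = 1)
    (hs : ∀ k, S (k + 1) = statUpdate (S k) (G k * (G k)ᵀ))
    (hG : ∀ k < K, specNorm (G k) ≤ 1) :
    (matrixRpow (S K) (-(1 / 2))).trace ≤ m * √(1 + K) := by
  obtain ⟨h1, -, h3⟩ := statistic_bounds h0 hs hG K le_rfl
  have h := smul_one_sub_matrixRpow_half_posSemidef h1 (by positivity) h3
  refine trace_le_of_smul_one_sub_posSemidef ?_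
  convert h using 3
  norm_num

theorem trace_statistic_rpow_neg_quarter_le (h0 : S 0 = 1)
    (hs : ∀ k, S (k + 1) = statUpdate (S k) (G k * (G k)ᵀ))
    (hG : ∀ k < K, specNorm (G k) ≤ 1) :
    (matrixRpow (S K) (-(1 / 4))).trace ≤ m * √(√(1 + K)) := by
  obtain ⟨h1, -, h3⟩ := statistic_bounds h0 hs hG K le_rfl
  have h := smul_one_sub_matrixRpow_half_posSemidef h1 (Real.sqrt_nonneg _)
    (smul_one_sub_matrixRpow_half_posSemidef h1 (by positivity) h3)
  refine trace_le_of_smul_one_sub_posSemidef ?_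
  convert h using 3
  norm_num

theorem sum_trace_statistic_le (h0 : S 0 = 1)
    (hs : ∀ k, S (k + 1) = statUpdate (S k) (G k * (G k)ᵀ))
    (hG : ∀ k < K, specNorm (G k) ≤ 1) :
    ∑ k ∈ Finset.range K, (matrixRpow (S (k + 1)) (1 / 2) * (G k * (G k)ᵀ)).trace ≤
      (1 + √m) * (2 * (m * √(1 + K))) := by
  have hstep : ∀ k ∈ Finset.range K,
      (matrixRpow (S (k + 1)) (1 / 2) * (G k * (G k)ᵀ)).trace ≤
        (1 + √m) * (2 * ((matrixRpow (S (k + 1)) (-(1 / 2))).trace -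
          (matrixRpow (S k) (-(1 / 2))).trace)) := by
    intro k hk
    rw [Finset.mem_range] at hk
    have hA := posSemidef_mul_transpose_self (G k)
    obtain ⟨h1, h2, -⟩ := statistic_bounds h0 hs hG k hk.le
    obtain ⟨g1, -, g3, -⟩ := statUpdate_spec h1 hA
    rw [← hs] at g1 g3
    refine trace_sqrt_mul_le g1 h1 hA ?_ ?_ g3
    · have := frobNorm_nonneg (G k * (G k)ᵀ * S k)
      positivity
    · have := frobNorm_mul_le h1.posSemidef h2 (hG k hk)
      linarith
  refine (Finset.sum_le_sum hstep).trans ?_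
  rw [← Finset.mul_sum, ← Finset.mul_sum,
    Finset.sum_range_sub fun k => (matrixRpow (S k) (-(1 / 2))).trace]
  have h1 := trace_statistic_rpow_neg_half_le h0 hs hG
  have h2 : 0 ≤ (matrixRpow (S 0) (-(1 / 2))).trace :=
    (posDef_matrixRpow (posDef_statistic h0 hs 0) _).posSemidef.trace_nonneg
  gcongr
  linarith

end Statistic

/-! ### Energy in the changing metric -/

section Energy

theorem energy_step {P P' : Matrix (Fin m) (Fin m) ℝ} {Q Q' : Matrix (Fin n) (Fin n) ℝ}
    (hP : Pᵀ = P) (hQ : Qᵀ = Q) (hQ' : Q'ᵀ = Q') (hPP : P * P' = 1)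
    (hQQ : Q' * Q = 1) (η : ℝ) (X G : Matrix (Fin m) (Fin n) ℝ) :
    2 * η * (Gᵀ * X).trace = (Xᵀ * P * X * Q).trace -
      ((X - η • (P' * G * Q'))ᵀ * P * (X - η • (P' * G * Q')) * Q).trace +
      η ^ 2 * ((P' * G)ᵀ * (G * Q')).trace := by
  set Y := P' * G * Q' with hY
  have hPYQ : P * Y * Q = G := by
    rw [hY]
    calc P * (P' * G * Q') * Q = (P * P') * G * (Q' * Q) := by simp only [Matrix.mul_assoc]
      _ = G := by rw [hPP, hQQ, Matrix.one_mul, Matrix.mul_one]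
  have e1 : (Xᵀ * P * Y * Q).trace = (Gᵀ * X).trace := by
    rw [← trace_transpose (Gᵀ * X), transpose_mul, transpose_transpose, ← hPYQ]
    simp only [Matrix.mul_assoc]
  have e2 : (Yᵀ * P * X * Q).trace = (Gᵀ * X).trace := by
    rw [trace_mul_comm, ← hPYQ, transpose_mul (P * Y), transpose_mul P, hP, hQ]
    simp only [Matrix.mul_assoc]
  have e3 : (Yᵀ * P * Y * Q).trace = ((P' * G)ᵀ * (G * Q')).trace := by
    have : Yᵀ * P * Y * Q = Yᵀ * (P * Y * Q) := by simp only [Matrix.mul_assoc]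
    rw [this, hPYQ, hY, transpose_mul _ Q', hQ', Matrix.mul_assoc, trace_mul_comm, Matrix.mul_assoc]
  have e4 : (X - η • Y)ᵀ * P * (X - η • Y) * Q = Xᵀ * P * X * Q - η • (Xᵀ * P * Y * Q) -
      η • (Yᵀ * P * X * Q) + η ^ 2 • (Yᵀ * P * Y * Q) := by
    rw [transpose_sub, transpose_smul]
    simp only [Matrix.sub_mul, Matrix.mul_sub, Matrix.smul_mul, Matrix.mul_smul, sq]
    module
  rw [e4]
  simp only [trace_add, trace_sub, trace_smul, e1, e2, e3, smul_eq_mul]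
  ring

theorem sum_energy_le {P : ℕ → Matrix (Fin m) (Fin m) ℝ} {Q : ℕ → Matrix (Fin n) (Fin n) ℝ}
    {X : ℕ → Matrix (Fin m) (Fin n) ℝ} {D : ℝ} {K : ℕ} (hP : ∀ k, (P k).PosSemidef)
    (hQ : ∀ k, (Q k).PosSemidef) (hPm : ∀ k, (P (k + 1) - P k).PosSemidef)
    (hQm : ∀ k, (Q (k + 1) - Q k).PosSemidef) (hX : ∀ k < K, frobNorm (X k) ≤ D) (hK : 0 < K) :
    ∑ k ∈ Finset.range K, (((X k)ᵀ * P (k + 1) * X k * Q (k + 1)).trace -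
      ((X (k + 1))ᵀ * P (k + 1) * X (k + 1) * Q (k + 1)).trace) ≤
      D ^ 2 * ((P K).trace * (Q K).trace) := by
  have hsq (k : ℕ) (hk : k < K) : frobNorm (X k) ^ 2 ≤ D ^ 2 :=
    pow_le_pow_left₀ (frobNorm_nonneg _) (hX k hk) 2
  have hquad {M : Matrix (Fin m) (Fin m) ℝ} {N : Matrix (Fin n) (Fin n) ℝ}
      (hM : M.PosSemidef) (hN : N.PosSemidef) (k : ℕ) (hk : k < K) :
      ((X k)ᵀ * M * X k * N).trace ≤ D ^ 2 * (M.trace * N.trace) :=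
    (trace_quadratic_le hM hN (X k)).trans
      (mul_le_mul_of_nonneg_right (hsq k hk) (mul_nonneg hM.trace_nonneg hN.trace_nonneg))
  -- Retaining the current energy makes the induction close: changing the metric at `X j` costs at
  -- most `D²` times the increment of `tr P * tr Q`, split into a `P` part and a `Q` part.
  suffices h : ∀ j ≤ K, ∑ k ∈ Finset.range j, (((X k)ᵀ * P (k + 1) * X k * Q (k + 1)).trace -
      ((X (k + 1))ᵀ * P (k + 1) * X (k + 1) * Q (k + 1)).trace) ≤
      D ^ 2 * ((P j).trace * (Q j).trace) - ((X j)ᵀ * P j * X j * Q j).trace by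
    have h1 := h K le_rfl
    have h2 := trace_mul_nonneg ((hP K).transpose_conj (X K)) (hQ K)
    linarith
  intro j
  induction j with
  | zero =>
    intro _
    have := hquad (hP 0) (hQ 0) 0 hK
    simpa using this
  | succ j ih =>
    intro hj
    rw [Finset.sum_range_succ]
    have h1 := ih (by omega)
    have h2 := hquad (hPm j) (hQ (j + 1)) j hj
    have h3 := hquad (hP j) (hQm j) j hj
    rw [Matrix.mul_sub, Matrix.sub_mul, Matrix.sub_mul, trace_sub, trace_sub] at h2
    rw [Matrix.mul_sub, trace_sub, trace_sub] at h3
    linarith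

theorem preconditioned_trace_le {L : Matrix (Fin m) (Fin m) ℝ} {R : Matrix (Fin n) (Fin n) ℝ}
    (hL : L.PosDef) (hR : R.PosDef) (G : Matrix (Fin m) (Fin n) ℝ) :
    2 * ((matrixRpow L (1 / 4) * G)ᵀ * (G * matrixRpow R (1 / 4))).trace ≤
      (matrixRpow L (1 / 2) * (G * Gᵀ)).trace + (matrixRpow R (1 / 2) * (Gᵀ * Gᵀᵀ)).trace := by
  refine (trace_transpose_mul_le _ _).trans (le_of_eq ?_)
  have eL : matrixRpow L (1 / 4) * matrixRpow L (1 / 4) = matrixRpow L (1 / 2) := by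
    rw [matrixRpow_mul_matrixRpow hL]; norm_num
  have eR : matrixRpow R (1 / 4) * matrixRpow R (1 / 4) = matrixRpow R (1 / 2) := by
    rw [matrixRpow_mul_matrixRpow hR]; norm_num
  rw [transpose_mul, transpose_mul, (posDef_matrixRpow hL _).posSemidef.transpose_eq,
    (posDef_matrixRpow hR _).posSemidef.transpose_eq, ← eL, ← eR, transpose_transpose]
  congr 1
  · rw [Matrix.mul_assoc, trace_mul_comm]
    simp only [Matrix.mul_assoc]
  · rw [Matrix.mul_assoc (matrixRpow R (1 / 4)) (matrixRpow R (1 / 4)),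
      trace_mul_comm (matrixRpow R (1 / 4)) (matrixRpow R (1 / 4) * (Gᵀ * G))]
    simp only [Matrix.mul_assoc]

end Energy

/-! ### Regret bound -/

section Regret

variable {η D : ℝ} {f : ℕ → Matrix (Fin m) (Fin n) ℝ → ℝ} {W₀ Wstar : Matrix (Fin m) (Fin n) ℝ}
  {K : ℕ}

theorem two_mul_regret_le (hη : 0 < η) (hK : 0 < K)
    (hc : ∀ k < K, ConvexOn ℝ Set.univ (f k))
    (hd : ∀ k < K, DifferentiableAt ℝ (f k) (iterate η f W₀ k))
    (hD : ∀ k < K, frobNorm (iterate η f W₀ k - Wstar) ≤ D)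
    (hG : ∀ k < K, specNorm (matrixGradient (f k) (iterate η f W₀ k)) ≤ 1) :
    2 * η * regret η f W₀ Wstar K ≤
      (D ^ 2 * (m * n) + η ^ 2 * ((1 + √m) * m + (1 + √n) * n)) * √(1 + K) := by
  set G : ℕ → Matrix (Fin m) (Fin n) ℝ := fun k => matrixGradient (f k) (iterate η f W₀ k) with hGd
  set L : ℕ → Matrix (Fin m) (Fin m) ℝ := fun k => (run η f W₀ k).L with hL
  set R : ℕ → Matrix (Fin n) (Fin n) ℝ := fun k => (run η f W₀ k).R with hR
  set X : ℕ → Matrix (Fin m) (Fin n) ℝ := fun k => iterate η f W₀ k - Wstar with hX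
  have hL0 : L 0 = 1 := rfl
  have hR0 : R 0 = 1 := rfl
  have hLs : ∀ k, L (k + 1) = statUpdate (L k) (G k * (G k)ᵀ) := fun _ => rfl
  -- The double transpose makes `R` the left statistic of the gradients `Gᵀ`, so the same lemmas
  -- serve both sides.
  have hRs : ∀ k, R (k + 1) = statUpdate (R k) ((G k)ᵀ * (G k)ᵀᵀ) := fun _ => rfl
  have hXs : ∀ k, X (k + 1) = X k - η •
      (matrixRpow (L (k + 1)) (1 / 4) * G k * matrixRpow (R (k + 1)) (1 / 4)) :=
    fun k => sub_right_comm (iterate η f W₀ k) (η •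
      (matrixRpow (L (k + 1)) (1 / 4) * G k * matrixRpow (R (k + 1)) (1 / 4))) Wstar
  have hGt : ∀ k < K, specNorm (G k)ᵀ ≤ 1 := fun k hk => (specNorm_transpose _).trans_le (hG k hk)
  have hLp := posDef_statistic hL0 hLs
  have hRp := posDef_statistic hR0 hRs
  have hstep : ∀ k ∈ Finset.range K, 2 * η * (f k (iterate η f W₀ k) - f k Wstar) ≤
      (((X k)ᵀ * matrixRpow (L (k + 1)) (-(1 / 4)) * X k *
          matrixRpow (R (k + 1)) (-(1 / 4))).trace -
        ((X (k + 1))ᵀ * matrixRpow (L (k + 1)) (-(1 / 4)) * X (k + 1) *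
          matrixRpow (R (k + 1)) (-(1 / 4))).trace) +
      η ^ 2 / 2 * ((matrixRpow (L (k + 1)) (1 / 2) * (G k * (G k)ᵀ)).trace +
        (matrixRpow (R (k + 1)) (1 / 2) * ((G k)ᵀ * (G k)ᵀᵀ)).trace) := by
    intro k hk
    rw [Finset.mem_range] at hk
    have h1 := sub_le_trace_gradient (hc k hk) (hd k hk) Wstar
    have h2 := energy_step (posDef_matrixRpow (hLp (k + 1)) (-(1 / 4))).posSemidef.transpose_eq
      (posDef_matrixRpow (hRp (k + 1)) (-(1 / 4))).posSemidef.transpose_eq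
      (posDef_matrixRpow (hRp (k + 1)) (1 / 4)).posSemidef.transpose_eq
      (mul_eq_one_comm.1 (matrixRpow_mul_matrixRpow_neg (hLp (k + 1)) (1 / 4)))
      (matrixRpow_mul_matrixRpow_neg (hRp (k + 1)) (1 / 4)) η (X k) (G k)
    rw [← hXs] at h2
    have h3 := preconditioned_trace_le (hLp (k + 1)) (hRp (k + 1)) (G k)
    have h4 := mul_le_mul_of_nonneg_left h1 (by positivity : 0 ≤ 2 * η)
    have h5 := mul_le_mul_of_nonneg_left h3 (by positivity : 0 ≤ η ^ 2 / 2)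
    refine h4.trans (h2.le.trans ?_)
    linarith
  have hs := Finset.sum_le_sum hstep
  rw [← Finset.mul_sum, Finset.sum_add_distrib, ← Finset.mul_sum, Finset.sum_add_distrib] at hs
  have hE := sum_energy_le (D := D) (K := K)
    (P := fun k => matrixRpow (L k) (-(1 / 4))) (Q := fun k => matrixRpow (R k) (-(1 / 4))) (X := X)
    (fun k => (posDef_matrixRpow (hLp k) _).posSemidef)
    (fun k => (posDef_matrixRpow (hRp k) _).posSemidef)
    (statistic_rpow_neg_quarter_mono hL0 hLs) (statistic_rpow_neg_quarter_mono hR0 hRs) hD hK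
  have hLq := trace_statistic_rpow_neg_quarter_le hL0 hLs hG
  have hRq := trace_statistic_rpow_neg_quarter_le hR0 hRs hGt
  have hLR : (matrixRpow (L K) (-(1 / 4))).trace * (matrixRpow (R K) (-(1 / 4))).trace ≤
      m * n * √(1 + K) := by
    refine (mul_le_mul hLq hRq (posDef_matrixRpow (hRp K) _).posSemidef.trace_nonneg
      (by positivity)).trans (le_of_eq ?_)
    rw [mul_mul_mul_comm, Real.mul_self_sqrt (Real.sqrt_nonneg _)]
  have hLR' := mul_le_mul_of_nonneg_left hLR (sq_nonneg D)
  have hLS := sum_trace_statistic_le hL0 hLs hG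
  have hRS := sum_trace_statistic_le hR0 hRs hGt
  have hS := mul_le_mul_of_nonneg_left (add_le_add hLS hRS) (by positivity : 0 ≤ η ^ 2 / 2)
  refine hs.trans ((add_le_add (hE.trans hLR') hS).trans (le_of_eq ?_))
  ring

theorem regret_le (hη : 0 < η)
    (hc : ∀ k < K, ConvexOn ℝ Set.univ (f k))
    (hd : ∀ k < K, DifferentiableAt ℝ (f k) (iterate η f W₀ k))
    (hD : ∀ k < K, frobNorm (iterate η f W₀ k - Wstar) ≤ D)
    (hG : ∀ k < K, specNorm (matrixGradient (f k) (iterate η f W₀ k)) ≤ 1) :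
    regret η f W₀ Wstar K ≤
      (D ^ 2 / η * (m * n) + η * ((1 + √m) * m + (1 + √n) * n)) * √K := by
  rcases Nat.eq_zero_or_pos K with rfl | hK
  · simp [regret]
  have h := two_mul_regret_le hη hK hc hd hD hG
  have hK1 : (1 : ℝ) ≤ K := by exact_mod_cast hK
  -- This needs `K ≥ 1`; the factor 2 cancels against that of `2 * η`.
  have h2 : √(1 + K : ℝ) ≤ 2 * √K := by
    rw [Real.sqrt_le_left (by positivity), mul_pow, Real.sq_sqrt (by positivity)]
    linarith
  have h3 : (D ^ 2 * (m * n) + η ^ 2 * ((1 + √m) * m + (1 + √n) * n)) * √(1 + K) ≤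
      (D ^ 2 * (m * n) + η ^ 2 * ((1 + √m) * m + (1 + √n) * n)) * (2 * √K) :=
    mul_le_mul_of_nonneg_left h2 (by positivity)
  refine le_of_mul_le_mul_left ((h.trans h3).trans (le_of_eq ?_)) (by positivity : 0 < 2 * η)
  field_simp

end Regret

end KrADagrad

theorem mainTheorem1 (m n : ℕ) :
    ∃ C : ℝ, 0 < C ∧
      ∀ (f : ℕ → Matrix (Fin m) (Fin n) ℝ → ℝ) (W₀ Wstar : Matrix (Fin m) (Fin n) ℝ)
        (η D : ℝ) (K : ℕ),
        0 < η →
        (∀ k < K, ConvexOn ℝ Set.univ (f k)) →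
        (∀ k < K, DifferentiableAt ℝ (f k) (KrADagrad.iterate η f W₀ k)) →
        (∀ k < K, KrADagrad.frobNorm (KrADagrad.iterate η f W₀ k - Wstar) ≤ D) →
        ((∀ k < K, KrADagrad.IsOneLipschitz (f k)) →
          ∀ k < K, KrADagrad.specNorm
            (KrADagrad.matrixGradient (f k) (KrADagrad.iterate η f W₀ k)) ≤ 1) ∧
        ((∀ k < K, KrADagrad.specNorm
            (KrADagrad.matrixGradient (f k) (KrADagrad.iterate η f W₀ k)) ≤ 1) →
          KrADagrad.regret η f W₀ Wstar K ≤ C * (D ^ 2 / η + η) * Real.sqrt K) := by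
  -- The sum of the coefficients of `D ^ 2 / η` and `η`; the `+ 1` keeps it positive when `m = n =
  -- 0`.
  refine ⟨m * n + ((1 + √m) * m + (1 + √n) * n) + 1, by positivity,
    fun f W₀ Wstar η D K hη hc hd hD => ⟨fun hl k hk => ?_, fun hG => ?_⟩⟩
  · exact (KrADagrad.specNorm_le_frobNorm _).trans
      (KrADagrad.frobNorm_gradient_le_one (hl k hk) (hd k hk))
  · refine (KrADagrad.regret_le hη hc hd hD hG).trans
      (mul_le_mul_of_nonneg_right ?_ (Real.sqrt_nonneg _))
    have h1 : 0 ≤ D ^ 2 / η := by positivity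
    have h2 : (0 : ℝ) ≤ m * n := by positivity
    have h3 : 0 ≤ (1 + √m) * m + (1 + √n) * n := by positivity
    nlinarith
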